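/- **Setting.** Fix a schema of predicates with arities and a non-empty set $C$ of constants. A *rule* is an existential rule $\sigma:\ \forall\bar x\,(\varphi(\bar x)\to\exists\bar y\,\alpha(\bar x',\bar y))$, $\bar x'\subseteq\bar x$, with body a finite conjunction $\varphi$ of atoms and head a single atom $\alpha$ (terms are constants and variables); existential variables of different rules are regarded as different. A *database* $D$ is a finite set of facts over constants; in general facts may also contain labelled nulls. A *Boolean conjunctive query* (BCQ) $q$ is a finite conjunction of atoms, read existentially; $I\models q$ means that $q$ has a homomorphism (identity on constants) into the set $I$ of facts. A homomorphism between facts fixes constants and may send nulls to any terms. *Shy.* Let $\Sigma$ be a finite set of rules. The positions *invaded* by an existential variable $y$ form the least set containing every head position at which $y$ occurs, and every head position at which a universal variable occurs whose body occurrences are all in positions invaded by $y$. A universal variable of a rule is *attacked* by $y$ if it occurs in the body only in positions invaded by $y$, and *protected* if no existential variable attacks it. $\Sigma$ is Shy if in every rule (i) each variable occurring in more than one body atom is protected, and (ii) two distinct unprotected universal variables that both occur in the head and occur in two different body atoms are never attacked by the same variable. *Chase.* An applicable homomorphism of $\sigma$ in $I$ maps the body of $\sigma$ into $I$; firing it adds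 the head, with distinct fresh nulls for the existential variables. The *oblivious chase* $ochase(D,\Sigma)$ fires every applicable homomorphism once. An execution of the *parsimonious chase* $pchase(I,\Sigma)$ fires, in some order, applicable homomorphisms whose resulting fact $a$ satisfies the firing condition that there is no homomorphism from $\{a\}$ to the current set of facts, until no more can be fired. With $\lceil I\rfloor$ the result of replacing distinct nulls by distinct new constants (*freezing*), the *parsimonious chase with resumption* is $pchase_r(D,\Sigma,0)=D$, $pchase_r(D,\Sigma,i)=pchase(\lceil pchase_r(D,\Sigma,i-1)\rfloor,\Sigma)$. *Streaming chase.* For a set $I$ of facts and a predicate $p$, the *aggregate fact tree* $T_p$ is the tree whose nodes are the prefixes of argument tuples of $p$-facts of $I$ (no tree if there are none), with an edge from each prefix to its one-term extensions. $\mathrm{HomomorphismCheck}_S(a)$ for a fact $a=p(a_1,\dots,a_k)$ holds if there are no root-to-leaf path with terms $t_1,\dots,t_k$ in $T_p$ and no map $\theta$ fixing constants with $\theta(a_j)=t_j$ for all $j$. The streaming chase $chase_s(D,\Sigma)$ with $\mathit{maxRes}$ resumption iterations runs a pipeline with one node per rule. Each fact belongs to an iteration $1,\dots,\mathit{maxRes}$,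 each iteration has its own aggregate fact trees, and iteration $1$ starts with $D$. The steps, taken in any order until none is possible, are: the node of a rule pulls a not yet pulled fact of an iteration, with a predicate of its body, from the nodes producing it; the node of a rule fires an applicable homomorphism from its body to the facts it has pulled in an iteration, with nulls not used so far in any iteration, if the generated fact satisfies $\mathrm{HomomorphismCheck}_S$ for the trees of that iteration, whereupon the fact is added to the iteration and its trees; a fact of iteration $i<\mathit{maxRes}$ is frozen and, unless already present, proposed in (added to) iteration $i+1$ and its trees. The outcome is the set of facts of iteration $\mathit{maxRes}$. **Theorem.** Let $D$ be a database, $\Sigma$ a Shy set of rules, and $q$ a BCQ with $n$ distinct variables. Run both $pchase_r$ and $chase_s$, the latter with firing condition $\mathrm{HomomorphismCheck}_S$, with $\mathit{maxRes}=n+1$ iterations. Then $pchase_r$ has an execution with an outcome, every execution of $chase_s$ is finite, $chase_s$ has an execution with an outcome, and for every outcome $I$ of $pchase_r(D,\Sigma,n+1)$ and every outcome $J$ of $chase_s(D,\Sigma)$, whatever the order of rule activations in each, $$I\models q\iff J\models q,$$ and moreover $chase_s$ is correct for Boolean conjunctive query answering over Shy: $$ochase(D,\Sigma)\models q\iff J\models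 q.$$ -/

import Mathlib

namespace StreamingChase

/-! ### Terms, atoms, rules, queries -/

/-- Terms of rules and queries: constants and variables. -/
inductive Term (C V : Type*) where
  | const (c : C)
  | var (v : V)

/-- Terms of facts: the constants of the original vocabulary, the constants obtained by freezing
the null labelled `n`, and the labelled nulls. -/
inductive GTerm (C N : Type*) where
  | const (c : C)
  | frozen (n : N)
  | null (n : N)

/-- Atoms over a schema with predicates `P` of arities `ar` and with terms in `T`. -/
structure Atom {P : Type*} (ar : P → ℕ) (T : Type*) where
  pred : P
  args : Fin (ar pred) → T

section Language

variable {P : Type*} {ar : P → ℕ} {C V N T T' : Type*}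

/-- Apply a map of terms to an atom. -/
def Atom.map (f : T → T') (a : Atom ar T) : Atom ar T' := ⟨a.pred, fun i => f (a.args i)⟩

/-- The variable `x` occurs in the atom `a`. -/
def Atom.HasVar (a : Atom ar (Term C V)) (x : V) : Prop := ∃ i, a.args i = Term.var x

/-- The value of a term under an assignment of the variables. -/
def Term.subst (θ : V → GTerm C N) : Term C V → GTerm C N
  | .const c => .const c
  | .var v => θ v

/-- An existential rule with a single head atom. The variables of the head that do not occur in the
body are existentially quantified, all the variables of the body universally. -/
structure Rule {P : Type*} (ar : P → ℕ) (C V : Type*) where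
  body : Finset (Atom ar (Term C V))
  head : Atom ar (Term C V)

/-- The universally quantified variables of a rule. -/
def Rule.bodyVars (σ : Rule ar C V) : Set V := {x | ∃ b ∈ σ.body, b.HasVar x}

/-- The existentially quantified variables of a rule. -/
def Rule.existVars (σ : Rule ar C V) : Set V := {x | σ.head.HasVar x ∧ x ∉ σ.bodyVars}

/-- A Boolean conjunctive query: the existential closure of a finite conjunction of atoms. -/
abbrev BCQ {P : Type*} (ar : P → ℕ) (C V : Type*) := Finset (Atom ar (Term C V))

/-- The number of variables of a query. -/
noncomputable def numVars (q : BCQ ar C V) : ℕ := {x : V | ∃ a ∈ q, a.HasVar x}.ncard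

/-- A set of facts entails a query if the query has a homomorphism into it. -/
def Entails (I : Set (Atom ar (GTerm C N))) (q : BCQ ar C V) : Prop :=
  ∃ θ : V → GTerm C N, ∀ a ∈ q, a.map (Term.subst θ) ∈ I

/-! ### Shy sets of rules -/

/-- `Invaded S τ y p i`: the position `i` of `p` is invaded by the existential variable `y` of the
rule `τ ∈ S`. Existential variables of different rules count as different. -/
inductive Invaded (S : Finset (Rule ar C V)) (τ : Rule ar C V) (y : V) :
    (p : P) → Fin (ar p) → Prop where
  | exist (hτ : τ ∈ S) (hy : y ∈ τ.existVars) (i : Fin (ar τ.head.pred))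
      (hi : τ.head.args i = Term.var y) : Invaded S τ y τ.head.pred i
  | propagate (σ : Rule ar C V) (hσ : σ ∈ S) (x : V) (hx : x ∈ σ.bodyVars)
      (i : Fin (ar σ.head.pred)) (hi : σ.head.args i = Term.var x)
      (h : ∀ b ∈ σ.body, ∀ j, b.args j = Term.var x → Invaded S τ y b.pred j) :
      Invaded S τ y σ.head.pred i

/-- The universal variable `x` of `σ` is attacked by the existential variable `y` of `τ`: it occurs
in the body only in positions invaded by `y`. -/
def Attacked (S : Finset (Rule ar C V)) (τ : Rule ar C V) (y : V) (σ : Rule ar C V) (x : V) :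
    Prop :=
  x ∈ σ.bodyVars ∧ ∀ b ∈ σ.body, ∀ j, b.args j = Term.var x → Invaded S τ y b.pred j

/-- A universal variable is protected if no existential variable attacks it. -/
def IsProtected (S : Finset (Rule ar C V)) (σ : Rule ar C V) (x : V) : Prop :=
  ∀ τ y, ¬ Attacked S τ y σ x

/-- Shy sets of rules. -/
def Shy (S : Finset (Rule ar C V)) : Prop :=
  ∀ σ ∈ S,
    (∀ x, ∀ a ∈ σ.body, ∀ b ∈ σ.body, a ≠ b → a.HasVar x → b.HasVar x → IsProtected S σ x) ∧
    (∀ x z, x ≠ z → ¬ IsProtected S σ x → ¬ IsProtected S σ z →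
      σ.head.HasVar x → σ.head.HasVar z →
      (∃ a ∈ σ.body, ∃ b ∈ σ.body, a ≠ b ∧ a.HasVar x ∧ b.HasVar z) →
      ∀ τ y, ¬ (Attacked S τ y σ x ∧ Attacked S τ y σ z))

/-- An applicable homomorphism of `σ` in `I`: it maps the body of `σ` into `I`. (Its values at
other variables than those of the body play no role here.) -/
def Applicable (σ : Rule ar C V) (θ : V → GTerm C N) (I : Set (Atom ar (GTerm C N))) : Prop :=
  ∀ b ∈ σ.body, b.map (Term.subst θ) ∈ I

/-- A database, a finite set of facts without nulls, as a set of facts. -/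
def database (D : Finset (Atom ar C)) : Set (Atom ar (GTerm C N)) :=
  {a | ∃ d ∈ D, a = d.map GTerm.const}

end Language

/-! ### The oblivious chase -/

/-- The nulls of the oblivious chase: `mk σ y θ` is the null created for the existential variable
`y` when the rule `σ` is fired with the homomorphism `θ` from its body (`none` outside the variables
of the body). So every homomorphism is fired exactly once, with its own new nulls. -/
inductive ONull {P : Type*} (ar : P → ℕ) (C V : Type*) where
  | mk (σ : Rule ar C V) (y : V) (θ : V → Option (GTerm C (ONull ar C V)))

section Oblivious

variable {P : Type*} {ar : P → ℕ} {C V : Type*}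

open Classical in
/-- Extension of a homomorphism from the body of `σ` to the other variables by its new nulls. -/
noncomputable def oExtend (σ : Rule ar C V) (θ : V → GTerm C (ONull ar C V)) :
    V → GTerm C (ONull ar C V) :=
  fun v => if v ∈ σ.bodyVars then θ v
    else GTerm.null (ONull.mk σ v fun w => if w ∈ σ.bodyVars then some (θ w) else none)

/-- The oblivious chase: all facts obtained from the database by firing rules with all applicable
homomorphisms. -/
inductive OChase (D : Finset (Atom ar C)) (S : Finset (Rule ar C V)) :
    Atom ar (GTerm C (ONull ar C V)) → Prop where
  | base (d : Atom ar C) (hd : d ∈ D) : OChase D S (d.map GTerm.const)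
  | fire (σ : Rule ar C V) (hσ : σ ∈ S) (θ : V → GTerm C (ONull ar C V))
      (h : ∀ b ∈ σ.body, OChase D S (b.map (Term.subst θ))) :
      OChase D S (σ.head.map (Term.subst (oExtend σ θ)))

/-- The oblivious chase as a set of facts. -/
def ochase (D : Finset (Atom ar C)) (S : Finset (Rule ar C V)) :
    Set (Atom ar (GTerm C (ONull ar C V))) :=
  {a | OChase D S a}

end Oblivious

/-! ### The parsimonious chase with resumption -/

section Parsimonious

variable {P : Type*} {ar : P → ℕ} {C V : Type*}

/-- Facts with nulls labelled by natural numbers. -/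
abbrev Fact {P : Type*} (ar : P → ℕ) (C : Type*) := Atom ar (GTerm C ℕ)

/-- A homomorphism of ground terms fixes all constants (original and frozen ones) and is free on
nulls. -/
def IsHom (g : GTerm C ℕ → GTerm C ℕ) : Prop :=
  (∀ c, g (.const c) = .const c) ∧ ∀ n, g (.frozen n) = .frozen n

/-- The labels used in a set of facts, by nulls or by frozen nulls. -/
def labels (I : Set (Fact ar C)) : Set ℕ :=
  {n | ∃ a ∈ I, ∃ i, a.args i = .null n ∨ a.args i = .frozen n}

/-- `θ` maps the existential variables of `σ` injectively to nulls with labels outside `L`. -/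
def FreshOn (σ : Rule ar C V) (θ : V → GTerm C ℕ) (L : Set ℕ) : Prop :=
  (∀ y ∈ σ.existVars, ∃ n, n ∉ L ∧ θ y = .null n) ∧ Set.InjOn θ σ.existVars

/-- The firing condition of the parsimonious chase: the fact `a` has no homomorphism into `I`. -/
def HomomorphismCheck (I : Set (Fact ar C)) (a : Fact ar C) : Prop :=
  ¬ ∃ g, IsHom g ∧ a.map g ∈ I

/-- One step of the parsimonious chase: an applicable homomorphism, extended by fresh nulls, whose
head satisfies the firing condition is fired. -/
def PStep (S : Finset (Rule ar C V)) (I I' : Set (Fact ar C)) : Prop :=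
  ∃ σ ∈ S, ∃ θ : V → GTerm C ℕ, Applicable σ θ I ∧ FreshOn σ θ (labels I) ∧
    HomomorphismCheck I (σ.head.map (Term.subst θ)) ∧
    I' = insert (σ.head.map (Term.subst θ)) I

/-- `J` is the outcome of an execution (with some order of rule activations) of the parsimonious
chase on the set `I` of facts. -/
def IsPChase (I : Set (Fact ar C)) (S : Finset (Rule ar C V)) (J : Set (Fact ar C)) : Prop :=
  Relation.ReflTransGen (PStep S) I J ∧ ∀ J', ¬ PStep S J J'

/-- Freezing turns nulls into constants. -/
def GTerm.freeze : GTerm C ℕ → GTerm C ℕ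
  | .const c => .const c
  | .frozen n => .frozen n
  | .null n => .frozen n

/-- `IsPChaseR D S r I`: `I` is the outcome of an execution of the parsimonious chase with
resumption with `r` iterations, each of which is run on the frozen outcome of the previous one. -/
inductive IsPChaseR (D : Finset (Atom ar C)) (S : Finset (Rule ar C V)) :
    ℕ → Set (Fact ar C) → Prop where
  | zero : IsPChaseR D S 0 (database D)
  | succ (r : ℕ) (I J : Set (Fact ar C)) (hI : IsPChaseR D S r I)
      (hJ : IsPChase (Atom.map GTerm.freeze '' I) S J) : IsPChaseR D S (r + 1) J

end Parsimonious

/-! ### The streaming chase -/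

section Streaming

variable {P : Type*} {ar : P → ℕ} {C V : Type*}

/-- An aggregate fact tree, given by its node labels: the label of a node is the tuple of terms on
the path from the root, whose label is `[]`, and there is an edge labelled `x` from `l` to
`l ++ [x]`. The empty set stands for a tree that has not been created. -/
abbrev AFTree (C : Type*) := Set (List (GTerm C ℕ))

/-- The leaves of an aggregate fact tree. -/
def AFTree.IsLeaf (T : AFTree C) (t : List (GTerm C ℕ)) : Prop := t ∈ T ∧ ∀ x, t ++ [x] ∉ T

/-- A firing condition of the streaming chase decides on a fact by the aggregate fact trees, one per
predicate, of the facts generated so far. -/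
abbrev FiringCondition {P : Type*} (ar : P → ℕ) (C : Type*) :=
  (P → AFTree C) → Fact ar C → Prop

/-- The streaming homomorphism check: the tree of the predicate of `a` has no root-to-leaf path onto
which a homomorphism maps the terms of `a` position by position. -/
def HomomorphismCheckS : FiringCondition ar C := fun T a =>
  ¬ ∃ g, IsHom g ∧ ∃ t, (T a.pred).IsLeaf t ∧ (List.ofFn a.args).map g = t

/-- A state of the pipeline that a set of rules is compiled to. The pipeline has a node for each
rule, and facts are streamed to it from all nodes that produce a predicate of its body. Every fact
belongs to a resumption iteration. -/
structure State {P : Type*} (ar : P → ℕ) (C V : Type*) where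
  /-- the facts streamed in an iteration -/
  facts : ℕ → Set (Fact ar C)
  /-- the aggregate fact trees of an iteration -/
  trees : ℕ → P → AFTree C
  /-- the facts of an iteration that the node of a rule has pulled so far -/
  pulled : ℕ → Rule ar C V → Set (Fact ar C)

/-- The state after the fact `a` has been added to iteration `i`, and its path to the tree of its
predicate. -/
def State.emit (s : State ar C V) (i : ℕ) (a : Fact ar C) : State ar C V where
  facts := fun j => {b | b ∈ s.facts j ∨ j = i ∧ b = a}
  trees := fun j p => {l | l ∈ s.trees j p ∨ j = i ∧ p = a.pred ∧ l <+: List.ofFn a.args}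
  pulled := s.pulled

/-- The state after the node of `σ` has pulled the fact `a` in iteration `i`. -/
def State.pull (s : State ar C V) (i : ℕ) (σ : Rule ar C V) (a : Fact ar C) : State ar C V where
  facts := s.facts
  trees := s.trees
  pulled := fun j τ => {b | b ∈ s.pulled j τ ∨ j = i ∧ τ = σ ∧ b = a}

/-- The labels used in a state. -/
def State.labels (s : State ar C V) : Set ℕ := {n | ∃ i, n ∈ StreamingChase.labels (s.facts i)}

/-- The initial state: the facts of the database are streamed in iteration `1`. -/
def State.init (D : Finset (Atom ar C)) : State ar C V where
  facts := fun i => {a | i = 1 ∧ a ∈ database D}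
  trees := fun i p => {l | i = 1 ∧ ∃ a ∈ (database D : Set (Fact ar C)),
    a.pred = p ∧ l <+: List.ofFn a.args}
  pulled := fun _ _ => ∅

/-- The steps of the streaming chase with firing condition `F` and `maxRes` iterations. Any order of
the steps is allowed, in particular any scheduling of the nodes of the pipeline, and an iteration
need not wait until the previous one is complete. -/
inductive SStep (S : Finset (Rule ar C V)) (F : FiringCondition ar C) (maxRes : ℕ) :
    State ar C V → State ar C V → Prop where
  /-- The node of `σ` pulls a new fact from one of the nodes it depends on. -/
  | pull (s : State ar C V) (i : ℕ) (σ : Rule ar C V) (hσ : σ ∈ S) (a : Fact ar C)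
      (ha : a ∈ s.facts i) (hp : ∃ b ∈ σ.body, b.pred = a.pred) (hn : a ∉ s.pulled i σ) :
      SStep S F maxRes s (s.pull i σ a)
  /-- The node of `σ` fires a homomorphism from the body of `σ` to the facts it has pulled, provided
  that the generated fact satisfies the firing condition. -/
  | fire (s : State ar C V) (i : ℕ) (σ : Rule ar C V) (hσ : σ ∈ S) (θ : V → GTerm C ℕ)
      (hi : 1 ≤ i ∧ i ≤ maxRes) (hθ : Applicable σ θ (s.pulled i σ))
      (hfresh : FreshOn σ θ s.labels)
      (hF : F (s.trees i) (σ.head.map (Term.subst θ))) :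
      SStep S F maxRes s (s.emit i (σ.head.map (Term.subst θ)))
  /-- A fact of an iteration is frozen and proposed in the next iteration. -/
  | resume (s : State ar C V) (i : ℕ) (hi : 1 ≤ i ∧ i < maxRes) (a : Fact ar C)
      (ha : a ∈ s.facts i) (hn : a.map GTerm.freeze ∉ s.facts (i + 1)) :
      SStep S F maxRes s (s.emit (i + 1) (a.map GTerm.freeze))

/-- `J` is the outcome of an execution of the streaming chase: the facts of the last iteration in a
state in which no step is possible any more. -/
def IsStreamingChase (D : Finset (Atom ar C)) (S : Finset (Rule ar C V))
    (F : FiringCondition ar C) (maxRes : ℕ) (J : Set (Fact ar C)) : Prop :=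
  ∃ s : State ar C V, Relation.ReflTransGen (SStep S F maxRes) (State.init D) s ∧
    (∀ s', ¬ SStep S F maxRes s s') ∧ J = s.facts maxRes

/-- Every execution of the streaming chase is finite. -/
def StreamingChaseTerminates (D : Finset (Atom ar C)) (S : Finset (Rule ar C V))
    (F : FiringCondition ar C) (maxRes : ℕ) : Prop :=
  ¬ ∃ run : ℕ → State ar C V, run 0 = State.init D ∧ ∀ k, SStep S F maxRes (run k) (run (k + 1))

end Streaming

end StreamingChase

/-!
A homomorphism is glued from homomorphisms of single facts as soon as these agree on the shared
nulls. In a Shy set of rules they hardly share any: a variable that joins body atoms takes no nulls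
as values in the oblivious chase, and a null that several head variables share comes from a single
body atom. So each single fact of the oblivious chase maps into every outcome of the parsimonious
chase, although this chase suppresses facts. A query atom is mapped in the same way once the nulls
that it shares with the others have been mapped to constants. Each resumption freezes the image of
one more null, where a null goes after those from which it was created; hence after the first
iteration one further iteration per query variable suffices.

Conversely, a map of the labels of the nulls, which freezing does not change, sends each fact of a
parsimonious chase into the oblivious chase. Termination holds because a fact that passes the
homomorphism check has a new pattern of predicate, fixed terms and equalities between terms, and the
terms available allow finitely many patterns only. These arguments use nothing about the order of
the steps except that all facts of an iteration are eventually pulled and resumed, so they apply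
to the streaming chase as well.
-/

namespace StreamingChase

/-! ### Lifting maps of labels to terms and atoms -/

section Maps

variable {P : Type*} {ar : P → ℕ} {C V N M T T' : Type*}

theorem Atom.map_congr {f g : T → T'} {a : Atom ar T}
    (h : ∀ i, f (a.args i) = g (a.args i)) : a.map f = a.map g := by
  simp only [Atom.map, h]

theorem Atom.map_subst_congr {θ θ' : V → GTerm C N} {a : Atom ar (Term C V)}
    (h : ∀ x, a.HasVar x → θ x = θ' x) : a.map (Term.subst θ) = a.map (Term.subst θ') := by
  refine Atom.map_congr fun i => ?_
  cases hi : a.args i with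
  | const c => rfl
  | var x => exact h x ⟨i, hi⟩

theorem Atom.map_subst_map {f : GTerm C N → GTerm C M} (hf : ∀ c, f (.const c) = .const c)
    (θ : V → GTerm C N) (a : Atom ar (Term C V)) :
    (a.map (Term.subst θ)).map f = a.map (Term.subst (f ∘ θ)) := by
  change a.map (f ∘ Term.subst θ) = _
  refine Atom.map_congr fun i => ?_
  cases hi : a.args i with
  | const c => exact hf c
  | var x => rfl

theorem Atom.map_subst_args {θ : V → GTerm C N} {a : Atom ar (Term C V)} {i : Fin (ar a.pred)}
    {x : V} (hi : a.args i = .var x) : (a.map (Term.subst θ)).args i = θ x := by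
  simp only [Atom.map, hi, Term.subst]

theorem Atom.finite_setOf_hasVar (a : Atom ar (Term C V)) : {x | a.HasVar x}.Finite :=
  (Set.finite_range a.args).preimage (f := Term.var)
    fun _ _ _ _ h => Term.var.inj h

theorem Entails.map {I : Set (Atom ar (GTerm C N))} {J : Set (Atom ar (GTerm C M))}
    {q : BCQ ar C V} (h : Entails I q) {f : GTerm C N → GTerm C M}
    (hf : ∀ c, f (.const c) = .const c) (hIJ : Set.MapsTo (Atom.map f) I J) : Entails J q := by
  obtain ⟨θ, hθ⟩ := h
  exact ⟨f ∘ θ, fun a ha => Atom.map_subst_map hf θ a ▸ hIJ (hθ a ha)⟩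

/-- The label of a null or of a frozen null. -/
def GTerm.label : GTerm C N → Option N
  | .const _ => none
  | .frozen n => some n
  | .null n => some n

/-- The map of ground terms that fixes the original constants and is given by `h` on the labels.
Frozen nulls are treated as nulls. -/
def GTerm.lift (h : N → GTerm C M) : GTerm C N → GTerm C M
  | .const c => .const c
  | .frozen n => h n
  | .null n => h n

theorem GTerm.lift_of_label {t : GTerm C N} {n : N} (ht : t.label = some n) (h : N → GTerm C M) :
    t.lift h = h n := by
  cases t <;> cases ht <;> rfl

theorem GTerm.lift_congr {h h' : N → GTerm C M} {t : GTerm C N}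
    (H : ∀ n, t.label = some n → h n = h' n) : t.lift h = t.lift h' := by
  cases t with
  | const c => rfl
  | frozen n => exact H n rfl
  | null n => exact H n rfl

theorem Atom.map_subst_lift (h : N → GTerm C M) (θ : V → GTerm C N) (a : Atom ar (Term C V)) :
    (a.map (Term.subst θ)).map (GTerm.lift h) = a.map (Term.subst fun x => (θ x).lift h) :=
  Atom.map_subst_map (fun _ => rfl) θ a

theorem GTerm.lift_freeze (h : ℕ → GTerm C M) (t : GTerm C ℕ) : t.freeze.lift h = t.lift h := by
  cases t <;> rfl

theorem GTerm.lift_freeze_comp (h : N → GTerm C ℕ) (t : GTerm C N) :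
    t.lift (GTerm.freeze ∘ h) = (t.lift h).freeze := by
  cases t <;> rfl

theorem GTerm.freeze_notMem_range_null (t : GTerm C ℕ) : t.freeze ∉ Set.range GTerm.null := by
  rintro ⟨n, hn⟩
  cases t <;> cases hn

theorem GTerm.exists_lift_eq {X : Set V} {f : V → GTerm C N} {ψ : V → GTerm C M} {L : Set N}
    {m : N → GTerm C M} (hconst : ∀ x ∈ X, ∀ c, f x = .const c → ψ x = .const c)
    (hpair : ∀ x ∈ X, ∀ z ∈ X, ∀ n, (f x).label = some n → (f z).label = some n → ψ x = ψ z)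
    (hm : ∀ x ∈ X, ∀ n ∈ L, (f x).label = some n → ψ x = m n) :
    ∃ g, Set.EqOn g m L ∧ ∀ x ∈ X, (f x).lift g = ψ x := by
  have image : ∀ n, ∃ t, (n ∈ L → t = m n) ∧ ∀ x ∈ X, (f x).label = some n → t = ψ x := by
    intro n
    by_cases hn : ∃ x ∈ X, (f x).label = some n
    · obtain ⟨x, hx, hxn⟩ := hn
      exact ⟨ψ x, fun hL => hm x hx n hL hxn, fun z hz hzn => hpair x hx z hz n hxn hzn⟩
    · exact ⟨m n, fun _ => rfl, fun x hx hxn => absurd ⟨x, hx, hxn⟩ hn⟩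
  choose g hgm hgψ using image
  refine ⟨g, hgm, fun x hx => ?_⟩
  cases hfx : f x with
  | const c => exact (hconst x hx c hfx).symm
  | frozen n => exact hgψ n x hx (congrArg GTerm.label hfx)
  | null n => exact hgψ n x hx (congrArg GTerm.label hfx)

theorem IsHom.apply_of_notMem_range_null {g : GTerm C ℕ → GTerm C ℕ} (hg : IsHom g)
    {t : GTerm C ℕ} (ht : t ∉ Set.range GTerm.null) : g t = t := by
  cases t with
  | const c => exact hg.1 c
  | frozen n => exact hg.2 n
  | null n => exact absurd ⟨n, rfl⟩ ht

theorem mem_labels {I : Set (Fact ar C)} {n : ℕ} :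
    n ∈ labels I ↔ ∃ a ∈ I, ∃ i, (a.args i).label = some n := by
  have label_iff (t : GTerm C ℕ) : t.label = some n ↔ t = .null n ∨ t = .frozen n := by
    cases t <;> simp [GTerm.label]
  simp only [labels, Set.mem_ofPred_eq, label_iff]

theorem Applicable.label_mem_labels {σ : Rule ar C V} {θ : V → GTerm C ℕ} {I : Set (Fact ar C)}
    (hθ : Applicable σ θ I) {x : V} (hx : x ∈ σ.bodyVars) {n : ℕ} (hn : (θ x).label = some n) :
    n ∈ labels I := by
  obtain ⟨b, hb, i, hi⟩ := hx
  exact mem_labels.2 ⟨_, hθ b hb, i, (Atom.map_subst_args hi).symm ▸ hn⟩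

end Maps

/-! ### Nulls of the oblivious chase -/

section Nulls

variable {P : Type*} {ar : P → ℕ} {C V : Type*}

open Classical in
/-- The part of a homomorphism that the nulls of the oblivious chase record. -/
noncomputable def bodyPart (σ : Rule ar C V) (θ : V → GTerm C (ONull ar C V)) :
    V → Option (GTerm C (ONull ar C V)) :=
  fun w => if w ∈ σ.bodyVars then some (θ w) else none

theorem oExtend_of_mem {σ : Rule ar C V} {x : V} (hx : x ∈ σ.bodyVars)
    (θ : V → GTerm C (ONull ar C V)) : oExtend σ θ x = θ x :=
  if_pos hx

theorem oExtend_of_notMem {σ : Rule ar C V} {x : V} (hx : x ∉ σ.bodyVars)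
    (θ : V → GTerm C (ONull ar C V)) : oExtend σ θ x = .null (.mk σ x (bodyPart σ θ)) :=
  if_neg hx

/-- The null `μ` occurs in the homomorphism recorded by the null `ν`, so that `μ` was created
earlier than `ν`. -/
def ONull.Older (μ : ONull ar C V) : ONull ar C V → Prop
  | .mk _ _ η => ∃ v, ∃ t ∈ η v, t.label = some μ

theorem ONull.older_wellFounded : WellFounded (ONull.Older (ar := ar) (C := C) (V := V)) := by
  refine ⟨fun ν => ?_⟩
  refine ONull.rec (motive_1 := fun ν => Acc ONull.Older ν)
    (motive_2 := fun o => ∀ t ∈ o, ∀ μ, t.label = some μ → Acc ONull.Older μ)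
    (motive_3 := fun t => ∀ μ, t.label = some μ → Acc ONull.Older μ) ?_ ?_ ?_ ?_ ?_ ?_ ν
  · exact fun σ y η ih => ⟨_, fun μ ⟨v, t, ht, hμ⟩ => ih v t ht μ hμ⟩
  · exact fun t ht => by cases ht
  · exact fun t ih t' ht' => Option.some.inj ht' ▸ ih
  · exact fun c μ h => by cases h
  · exact fun n ih μ h => Option.some.inj h ▸ ih
  · exact fun n ih μ h => Option.some.inj h ▸ ih

instance : IsWellFounded (ONull ar C V) ONull.Older := ⟨ONull.older_wellFounded⟩

theorem ONull.older_mk_bodyPart {σ : Rule ar C V} {θ : V → GTerm C (ONull ar C V)} {x : V}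
    (hx : x ∈ σ.bodyVars) {μ : ONull ar C V} (hμ : (θ x).label = some μ) (y : V) :
    ONull.Older μ (.mk σ y (bodyPart σ θ)) :=
  ⟨x, θ x, if_pos hx, hμ⟩

theorem eq_of_label_oExtend {σ : Rule ar C V} {θ : V → GTerm C (ONull ar C V)} {x z : V}
    (hz : (oExtend σ θ z).label = some (.mk σ x (bodyPart σ θ))) : z = x := by
  by_cases hzb : z ∈ σ.bodyVars
  · rw [oExtend_of_mem hzb] at hz
    exact absurd (ONull.older_mk_bodyPart hzb hz x) (irrefl _)
  · rw [oExtend_of_notMem hzb] at hz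
    cases hz
    rfl

theorem ONull.exists_newest {N : Finset (ONull ar C V)} (hN : N.Nonempty) :
    ∃ ν₀ ∈ N, ∀ ν ∈ N, ¬ ONull.Older ν₀ ν := by
  obtain ⟨ν₀, hν₀, hmax⟩ := N.exists_max_image (IsWellFounded.rank ONull.Older) hN
  exact ⟨ν₀, hν₀, fun ν hν h => (hmax ν hν).not_gt (IsWellFounded.rank_lt_of_rel h)⟩

/-- The fact in which a null of the oblivious chase is created. The variables without a recorded
value are the existential ones. -/
noncomputable def ONull.birth : ONull ar C V → Atom ar (GTerm C (ONull ar C V))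
  | .mk σ _ η => σ.head.map (Term.subst fun v => (η v).getD (.null (.mk σ v η)))

theorem ONull.birth_mk_bodyPart (σ : Rule ar C V) (y : V) (θ : V → GTerm C (ONull ar C V)) :
    (ONull.mk σ y (bodyPart σ θ)).birth = σ.head.map (Term.subst (oExtend σ θ)) := by
  refine Atom.map_subst_congr fun x _ => ?_
  by_cases hx : x ∈ σ.bodyVars
  · rw [oExtend_of_mem hx, bodyPart, if_pos hx]
    rfl
  · rw [oExtend_of_notMem hx]
    simp only [bodyPart, if_neg hx]
    rfl

theorem ONull.older_or_birth_eq {μ ν : ONull ar C V} {i : Fin (ar ν.birth.pred)}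
    (h : (ν.birth.args i).label = some μ) : ONull.Older μ ν ∨ μ.birth = ν.birth := by
  obtain ⟨σ, y, η⟩ := ν
  change (Term.subst _ (σ.head.args i)).label = some μ at h
  cases hi : σ.head.args i with
  | const c => rw [hi] at h; cases h
  | var x =>
    rw [hi] at h
    cases hx : η x with
    | some t => exact .inl ⟨x, t, hx, by simpa only [Term.subst, hx, Option.getD_some] using h⟩
    | none =>
      simp only [Term.subst, hx] at h
      cases h
      exact .inr rfl

variable {D : Finset (Atom ar C)} {S : Finset (Rule ar C V)}

theorem OChase.invaded {a : Atom ar (GTerm C (ONull ar C V))} (ha : a ∈ ochase D S)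
    {i : Fin (ar a.pred)} {τ : Rule ar C V} {y : V} {η : V → Option (GTerm C (ONull ar C V))}
    (hi : (a.args i).label = some (.mk τ y η)) : Invaded S τ y a.pred i := by
  induction ha with
  | base => cases hi
  | fire σ hσ θ h ih =>
    change (Term.subst _ (σ.head.args i)).label = _ at hi
    cases hx : σ.head.args i with
    | const c => rw [hx] at hi; cases hi
    | var x =>
      rw [hx, Term.subst] at hi
      by_cases hxb : x ∈ σ.bodyVars
      · rw [oExtend_of_mem hxb] at hi
        exact .propagate σ hσ x hxb i hx fun b hb j hj =>
          ih b hb ((Atom.map_subst_args hj).symm ▸ hi)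
      · rw [oExtend_of_notMem hxb] at hi
        cases hi
        exact .exist hσ ⟨⟨i, hx⟩, hxb⟩ i hx

theorem Applicable.attacked_of_label {σ : Rule ar C V} {θ : V → GTerm C (ONull ar C V)}
    (hθ : Applicable σ θ (ochase D S)) {x : V} (hx : x ∈ σ.bodyVars) {τ : Rule ar C V} {y : V}
    {η : V → Option (GTerm C (ONull ar C V))} (h : (θ x).label = some (.mk τ y η)) :
    Attacked S τ y σ x :=
  ⟨hx, fun b hb _ hj => OChase.invaded (hθ b hb) (Atom.map_subst_args (θ := θ) hj ▸ h)⟩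

end Nulls

/-! ### Completeness -/

section Completeness

variable {P : Type*} {ar : P → ℕ} {C V : Type*} {D : Finset (Atom ar C)}
  {S : Finset (Rule ar C V)} {σ : Rule ar C V} {θ : V → GTerm C (ONull ar C V)}

instance : Nonempty (GTerm C ℕ) := ⟨.frozen 0⟩

theorem Shy.eq_of_label_join (hS : Shy S) (hσ : σ ∈ S) (hθ : Applicable σ θ (ochase D S)) {x : V}
    {ν : ONull ar C V} (hx : (θ x).label = some ν) {a b : Atom ar (Term C V)} (ha : a ∈ σ.body)
    (hb : b ∈ σ.body) (hxa : a.HasVar x) (hxb : b.HasVar x) : a = b := by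
  by_contra hab
  obtain ⟨τ, y, η⟩ := ν
  exact (hS σ hσ).1 x a ha b hb hab hxa hxb τ y (hθ.attacked_of_label ⟨a, ha, hxa⟩ hx)

theorem Shy.eq_of_label_head (hS : Shy S) (hσ : σ ∈ S) (hθ : Applicable σ θ (ochase D S))
    {x z : V} (hx : σ.head.HasVar x) (hz : σ.head.HasVar z) {ν : ONull ar C V}
    (hxν : (θ x).label = some ν) (hzν : (θ z).label = some ν) {a b : Atom ar (Term C V)}
    (ha : a ∈ σ.body) (hb : b ∈ σ.body) (hxa : a.HasVar x) (hzb : b.HasVar z) : a = b := by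
  by_cases hxz : x = z
  · exact hS.eq_of_label_join hσ hθ hzν ha hb (hxz ▸ hxa) hzb
  by_contra hab
  obtain ⟨τ, y, η⟩ := ν
  have hx_att := hθ.attacked_of_label ⟨a, ha, hxa⟩ hxν
  have hz_att := hθ.attacked_of_label ⟨b, hb, hzb⟩ hzν
  exact (hS σ hσ).2 x z hxz (fun h => h τ y hx_att) (fun h => h τ y hz_att) hx hz
    ⟨a, ha, b, hb, hab, hxa, hzb⟩ τ y ⟨hx_att, hz_att⟩

theorem Shy.exists_common_lift (hS : Shy S) (hσ : σ ∈ S) (hθ : Applicable σ θ (ochase D S))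
    (g : Atom ar (Term C V) → ONull ar C V → GTerm C ℕ) :
    ∃ θ' : V → GTerm C ℕ, ∀ b ∈ σ.body, ∀ x, b.HasVar x → θ' x = (θ x).lift (g b) := by
  have atom_of_var : ∀ x, ∃ b, x ∈ σ.bodyVars → b ∈ σ.body ∧ b.HasVar x := by
    intro x
    by_cases hx : x ∈ σ.bodyVars
    · exact hx.imp fun b hb _ => hb
    · exact ⟨σ.head, fun h => absurd h hx⟩
  choose β hβ using atom_of_var
  refine ⟨fun x => (θ x).lift (g (β x)), fun b hb x hx => GTerm.lift_congr fun ν hν => ?_⟩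
  obtain ⟨hβ_mem, hβ_var⟩ := hβ x ⟨b, hb, hx⟩
  rw [hS.eq_of_label_join hσ hθ hν hβ_mem hb hβ_var hx]

/-- Every applicable homomorphism of a rule in `J` is satisfied in `J` up to a homomorphism of the
generated fact. The outcomes of the parsimonious chase have this property, which is what its firing
condition leaves of being closed under the rules. -/
def ParsimoniouslyClosed (S : Finset (Rule ar C V)) (J : Set (Fact ar C)) : Prop :=
  ∀ σ ∈ S, ∀ θ : V → GTerm C ℕ, Applicable σ θ J →
    ∃ g, IsHom g ∧ ∃ ψ : V → GTerm C ℕ, (∀ x ∈ σ.bodyVars, ψ x = g (θ x)) ∧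
      σ.head.map (Term.subst ψ) ∈ J

variable {J : Set (Fact ar C)} {N : Set (ONull ar C V)} {m : ONull ar C V → GTerm C ℕ}

theorem exists_lift_oExtend {X : Set V} {ψ : V → GTerm C ℕ}
    (hconst : ∀ x ∈ X, x ∈ σ.bodyVars → ∀ c, θ x = .const c → ψ x = .const c)
    (hpair : ∀ x ∈ X, x ∈ σ.bodyVars → ∀ z ∈ X, z ∈ σ.bodyVars → ∀ ν,
      (θ x).label = some ν → (θ z).label = some ν → ψ x = ψ z)
    (hm : ∀ x ∈ X, x ∈ σ.bodyVars → ∀ ν ∈ N, (θ x).label = some ν → ψ x = m ν)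
    (hN : ∀ y ∈ X, y ∉ σ.bodyVars → .mk σ y (bodyPart σ θ) ∉ N) :
    ∃ g, Set.EqOn g m N ∧ ∀ x ∈ X, (oExtend σ θ x).lift g = ψ x := by
  refine GTerm.exists_lift_eq (fun x hx c hc => ?_) (fun x hx z hz ν hxν hzν => ?_)
    fun x hx ν hν hxν => ?_ <;> by_cases hxb : x ∈ σ.bodyVars
  · exact hconst x hx hxb c (oExtend_of_mem hxb θ ▸ hc)
  · rw [oExtend_of_notMem hxb] at hc
    cases hc
  · by_cases hzb : z ∈ σ.bodyVars
    · exact hpair x hx hxb z hz hzb ν (oExtend_of_mem hxb θ ▸ hxν) (oExtend_of_mem hzb θ ▸ hzν)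
    · rw [oExtend_of_notMem hzb] at hzν
      cases hzν
      rw [eq_of_label_oExtend hxν]
  · rw [oExtend_of_notMem hxb] at hxν
    cases hxν
    rw [eq_of_label_oExtend hzν]
  · exact hm x hx hxb ν hν (oExtend_of_mem hxb θ ▸ hxν)
  · rw [oExtend_of_notMem hxb] at hxν
    cases hxν
    exact absurd hν (hN x hx hxb)

theorem Shy.exists_lift_head (hS : Shy S) (hJ : ParsimoniouslyClosed S J)
    (hm : ∀ ν ∈ N, m ν ∉ Set.range GTerm.null) (hσ : σ ∈ S) (hθ : Applicable σ θ (ochase D S))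
    (hN : ∀ y ∈ σ.existVars, .mk σ y (bodyPart σ θ) ∉ N)
    (ih : ∀ b ∈ σ.body, ∃ g, Set.EqOn g m N ∧ (b.map (Term.subst θ)).map (GTerm.lift g) ∈ J) :
    ∃ g, Set.EqOn g m N ∧ (σ.head.map (Term.subst (oExtend σ θ))).map (GTerm.lift g) ∈ J := by
  choose! g hgm hgJ using ih
  obtain ⟨θ', hθ'⟩ := hS.exists_common_lift hσ hθ g
  have hθ'J : Applicable σ θ' J := by
    intro b hb
    rw [Atom.map_subst_congr (hθ' b hb), ← Atom.map_subst_lift]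
    exact hgJ b hb
  obtain ⟨k, hk, ψ, hψ, hψJ⟩ := hJ σ hσ θ' hθ'J
  obtain ⟨G, hGm, hGψ⟩ : ∃ G, Set.EqOn G m N ∧
      ∀ x ∈ {x | σ.head.HasVar x}, (oExtend σ θ x).lift G = ψ x := by
    refine exists_lift_oExtend ?const ?pair ?prescribed fun y hy hyb => hN y ⟨hy, hyb⟩
    case const =>
      rintro x - ⟨b, hb, hxb⟩ c hc
      rw [hψ x ⟨b, hb, hxb⟩, hθ' b hb x hxb, hc]
      exact hk.1 c
    case pair =>
      rintro x hx ⟨a, ha, hxa⟩ z hz ⟨b, hb, hzb⟩ ν hxν hzν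
      obtain rfl := hS.eq_of_label_head hσ hθ hx hz hxν hzν ha hb hxa hzb
      rw [hψ x ⟨a, ha, hxa⟩, hψ z ⟨a, ha, hzb⟩, hθ' a ha x hxa, hθ' a ha z hzb,
        GTerm.lift_of_label hxν, GTerm.lift_of_label hzν]
    case prescribed =>
      rintro x - ⟨b, hb, hxb⟩ ν hν hxν
      rw [hψ x ⟨b, hb, hxb⟩, hθ' b hb x hxb, GTerm.lift_of_label hxν, hgm b hb hν,
        hk.apply_of_notMem_range_null (hm ν hν)]
  refine ⟨G, hGm, ?_⟩
  rw [Atom.map_subst_lift, Atom.map_subst_congr hGψ]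
  exact hψJ

theorem Shy.exists_lift_of_births (hS : Shy S) (hD : database D ⊆ J)
    (hJ : ParsimoniouslyClosed S J) (hm : ∀ ν ∈ N, m ν ∉ Set.range GTerm.null)
    (births : ∀ ν ∈ N, ν.birth ∈ ochase D S →
      ∃ g, Set.EqOn g m N ∧ ν.birth.map (GTerm.lift g) ∈ J)
    {a : Atom ar (GTerm C (ONull ar C V))} (ha : a ∈ ochase D S) :
    ∃ g, Set.EqOn g m N ∧ a.map (GTerm.lift g) ∈ J := by
  induction ha with
  | base d hd => exact ⟨m, fun _ _ => rfl, hD ⟨d, hd, rfl⟩⟩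
  | fire σ hσ θ h ih =>
    by_cases hN : ∃ y, .mk σ y (bodyPart σ θ) ∈ N
    · obtain ⟨y, hy⟩ := hN
      rw [← ONull.birth_mk_bodyPart σ y θ]
      exact births _ hy (ONull.birth_mk_bodyPart σ y θ ▸ .fire σ hσ θ h)
    · exact hS.exists_lift_head hJ hm hσ h (fun y _ hy => hN ⟨y, hy⟩) ih

/-- Every fact of the oblivious chase has a homomorphism into `I`, and the images of any `k` of the
nulls can be chosen simultaneously for all facts. -/
def Covers (D : Finset (Atom ar C)) (S : Finset (Rule ar C V)) (k : ℕ) (I : Set (Fact ar C)) :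
    Prop :=
  ∀ N : Finset (ONull ar C V), N.card ≤ k → ∃ m : ONull ar C V → GTerm C ℕ,
    ∀ a ∈ ochase D S, ∃ g, Set.EqOn g m N ∧ a.map (GTerm.lift g) ∈ I

variable {I : Set (Fact ar C)} {k : ℕ}

theorem Covers.database_subset (h : Covers D S k I) : database D ⊆ I := by
  rintro _ ⟨d, hd, rfl⟩
  obtain ⟨m, hm⟩ := h ∅ (Nat.zero_le k)
  obtain ⟨g, -, hg⟩ := hm _ (.base d hd)
  exact hg

theorem covers_zero (hS : Shy S) (hD : database D ⊆ J) (hJ : ParsimoniouslyClosed S J) :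
    Covers D S 0 J := by
  intro N hN
  obtain rfl := Finset.card_eq_zero.1 (Nat.le_zero.1 hN)
  refine ⟨fun _ => .frozen 0, fun a ha => hS.exists_lift_of_births hD hJ ?_ ?_ ha⟩ <;> simp

theorem database_subset_of_freeze (hD : database D ⊆ I) (hIJ : Atom.map GTerm.freeze '' I ⊆ J) :
    database D ⊆ J := by
  rintro _ ⟨d, hd, rfl⟩
  exact hIJ ⟨_, hD ⟨d, hd, rfl⟩, rfl⟩

theorem map_lift_freeze_comp_mem (hIJ : Atom.map GTerm.freeze '' I ⊆ J)
    {a : Atom ar (GTerm C (ONull ar C V))} {g : ONull ar C V → GTerm C ℕ}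
    (ha : a.map (GTerm.lift g) ∈ I) : a.map (GTerm.lift (GTerm.freeze ∘ g)) ∈ J := by
  have : a.map (GTerm.lift (GTerm.freeze ∘ g)) = (a.map (GTerm.lift g)).map GTerm.freeze :=
    Atom.map_congr (g := GTerm.freeze ∘ GTerm.lift g) fun i => GTerm.lift_freeze_comp g _
  exact this ▸ hIJ ⟨_, ha, rfl⟩

/-- A resumption makes one more null available: the newest null `ν₀` of `N` can be mapped to the
frozen image that it has in the fact of its creation, because neither it nor any null created with
it occurs in the facts in which the other nulls of `N` are created. -/
theorem Covers.succ (hS : Shy S) (hI : Covers D S k I) (hIJ : Atom.map GTerm.freeze '' I ⊆ J)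
    (hJ : ParsimoniouslyClosed S J) : Covers D S (k + 1) J := by
  classical
  intro N hN
  rcases N.eq_empty_or_nonempty with rfl | hne
  · exact covers_zero hS (database_subset_of_freeze hI.database_subset hIJ) hJ ∅ le_rfl
  obtain ⟨ν₀, hν₀, newest⟩ := ONull.exists_newest hne
  obtain ⟨m, hmI⟩ := hI (N.erase ν₀) (by rw [Finset.card_erase_of_mem hν₀]; omega)
  obtain ⟨g₀, hg₀m, hg₀I⟩ : ∃ g₀, Set.EqOn g₀ m (N.erase ν₀) ∧
      (ν₀.birth ∈ ochase D S → ν₀.birth.map (GTerm.lift g₀) ∈ I) := by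
    by_cases h : ν₀.birth ∈ ochase D S
    · exact (hmI _ h).imp fun g hg => ⟨hg.1, fun _ => hg.2⟩
    · exact ⟨m, fun _ _ => rfl, fun h' => absurd h' h⟩
  have frozen : ∀ ν ∈ N, (GTerm.freeze ∘ g₀) ν ∉ Set.range GTerm.null :=
    fun ν _ => GTerm.freeze_notMem_range_null _
  refine ⟨GTerm.freeze ∘ g₀, fun a ha => hS.exists_lift_of_births
    (database_subset_of_freeze hI.database_subset hIJ) hJ frozen (fun ν hν hbirth => ?_) ha⟩
  by_cases hsib : ν.birth = ν₀.birth
  · rw [hsib] at hbirth ⊢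
    exact ⟨_, fun _ _ => rfl, map_lift_freeze_comp_mem hIJ (hg₀I hbirth)⟩
  obtain ⟨g, hgm, hgI⟩ := hmI _ hbirth
  refine ⟨Function.update (GTerm.freeze ∘ g) ν₀ (g₀ ν₀).freeze, fun μ hμ => ?_, ?_⟩
  · by_cases hμν₀ : μ = ν₀
    · rw [hμν₀, Function.update_self, Function.comp_apply]
    · have hμ' : μ ∈ (N.erase ν₀ : Set (ONull ar C V)) :=
        Finset.mem_coe.2 (Finset.mem_erase.2 ⟨hμν₀, hμ⟩)
      rw [Function.update_of_ne hμν₀, Function.comp_apply, Function.comp_apply, hgm hμ', hg₀m hμ']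
  · have absent : ∀ i, (ν.birth.args i).label ≠ some ν₀ := fun i hi =>
      (ONull.older_or_birth_eq hi).elim (newest ν hν) fun h => hsib h.symm
    convert map_lift_freeze_comp_mem hIJ hgI using 1
    refine Atom.map_congr fun i => GTerm.lift_congr fun μ hμ => Function.update_of_ne ?_ _ _
    rintro rfl
    exact absent i hμ

theorem BCQ.finite_vars (q : BCQ ar C V) : {x : V | ∃ a ∈ q, a.HasVar x}.Finite := by
  have : {x : V | ∃ a ∈ q, a.HasVar x} = ⋃ a ∈ q, {x | a.HasVar x} := by
    ext
    simp only [Set.mem_ofPred_eq, Set.mem_iUnion, exists_prop]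
  exact this ▸ q.finite_toSet.biUnion fun a _ => a.finite_setOf_hasVar

theorem Covers.entails (h : Covers D S k I) {q : BCQ ar C V} (hk : numVars q ≤ k)
    (hq : Entails (ochase D S) q) : Entails I q := by
  classical
  obtain ⟨θ, hθ⟩ := hq
  let N : Finset (ONull ar C V) := (q.finite_vars.toFinset.image fun x => (θ x).label).eraseNone
  have hN : N.card ≤ k := by
    refine (Finset.card_eraseNone_le _).trans (Finset.card_image_le.trans (le_trans ?_ hk))
    exact (Set.ncard_eq_toFinset_card _ q.finite_vars).ge
  obtain ⟨m, hm⟩ := h N hN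
  refine ⟨fun x => (θ x).lift m, fun a ha => ?_⟩
  obtain ⟨g, hgm, hgI⟩ := hm _ (hθ a ha)
  rw [Atom.map_subst_lift] at hgI
  convert hgI using 1
  refine Atom.map_subst_congr fun x hx => GTerm.lift_congr fun ν hν => (hgm ?_).symm
  exact Finset.mem_eraseNone.2
    (Finset.mem_image.2 ⟨x, q.finite_vars.mem_toFinset.2 ⟨a, ha, hx⟩, hν⟩)

end Completeness

/-! ### Soundness -/

section Soundness

variable {P : Type*} {ar : P → ℕ} {C V N : Type*} {D : Finset (Atom ar C)}
  {S : Finset (Rule ar C V)} {I J : Set (Fact ar C)}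

/-- A single map of labels sends all facts of `I` to facts of the oblivious chase. -/
def MapsIntoOChase (D : Finset (Atom ar C)) (S : Finset (Rule ar C V)) (I : Set (Fact ar C)) :
    Prop :=
  ∃ h, Set.MapsTo (Atom.map (GTerm.lift h)) I (ochase D S)

theorem mapsIntoOChase_database [Nonempty C] (D : Finset (Atom ar C)) (S : Finset (Rule ar C V)) :
    MapsIntoOChase D S (database D) := by
  refine ⟨fun _ => .const (Classical.arbitrary C), ?_⟩
  rintro _ ⟨d, hd, rfl⟩
  exact .base d hd

theorem MapsIntoOChase.mono (h : MapsIntoOChase D S J) (hIJ : I ⊆ J) : MapsIntoOChase D S I :=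
  h.imp fun _ h => h.mono_left hIJ

theorem MapsIntoOChase.union_image_freeze (h : MapsIntoOChase D S I) :
    MapsIntoOChase D S (I ∪ Atom.map GTerm.freeze '' I) := by
  refine h.imp fun h hI => hI.union ?_
  rintro _ ⟨a, ha, rfl⟩
  have : (a.map GTerm.freeze).map (GTerm.lift h) = a.map (GTerm.lift h) :=
    Atom.map_congr (f := GTerm.lift h ∘ GTerm.freeze) (a := a) fun _ => GTerm.lift_freeze h _
  exact this ▸ hI ha

theorem FreshOn.exists_lift_eq {σ : Rule ar C V} {θ : V → GTerm C ℕ} {L : Set ℕ}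
    (hfresh : FreshOn σ θ L) (hL : ∀ x ∈ σ.bodyVars, ∀ n, (θ x).label = some n → n ∈ L)
    {h : ℕ → GTerm C N} {ψ : V → GTerm C N} (hψ : ∀ x ∈ σ.bodyVars, ψ x = (θ x).lift h) :
    ∃ g, Set.EqOn g h L ∧ ∀ x ∈ {x | σ.head.HasVar x}, (θ x).lift g = ψ x := by
  have exist {x} (hx : σ.head.HasVar x) (hxb : x ∉ σ.bodyVars) {n} (hxn : (θ x).label = some n) :
      n ∉ L ∧ θ x = .null n := by
    obtain ⟨k, hk, hxk⟩ := hfresh.1 x ⟨hx, hxb⟩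
    rw [hxk] at hxn ⊢
    cases hxn
    exact ⟨hk, rfl⟩
  have ψ_of_label : ∀ x ∈ {x | σ.head.HasVar x}, ∀ n ∈ L, (θ x).label = some n → ψ x = h n := by
    intro x hx n hn hxn
    by_cases hxb : x ∈ σ.bodyVars
    · exact (hψ x hxb).trans (GTerm.lift_of_label hxn h)
    · exact absurd hn (exist hx hxb hxn).1
  refine GTerm.exists_lift_eq (fun x hx c hc => ?_) (fun x hx z hz n hxn hzn => ?_) ψ_of_label
  · by_cases hxb : x ∈ σ.bodyVars
    · rw [hψ x hxb, hc]
      rfl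
    · obtain ⟨n, -, hn⟩ := hfresh.1 x ⟨hx, hxb⟩
      cases hc.symm.trans hn
  · by_cases hn : n ∈ L
    · rw [ψ_of_label x hx n hn hxn, ψ_of_label z hz n hn hzn]
    have hxb : x ∉ σ.bodyVars := fun hxb => hn (hL x hxb n hxn)
    have hzb : z ∉ σ.bodyVars := fun hzb => hn (hL z hzb n hzn)
    rw [hfresh.2 ⟨hx, hxb⟩ ⟨hz, hzb⟩ ((exist hx hxb hxn).2.trans (exist hz hzb hzn).2.symm)]

theorem MapsIntoOChase.insert_head (hI : MapsIntoOChase D S I) {σ : Rule ar C V} (hσ : σ ∈ S)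
    {θ : V → GTerm C ℕ} (hθ : Applicable σ θ I) (hfresh : FreshOn σ θ (labels I)) :
    MapsIntoOChase D S (insert (σ.head.map (Term.subst θ)) I) := by
  obtain ⟨h, hI⟩ := hI
  obtain ⟨g, hgh, hgθ⟩ := hfresh.exists_lift_eq (fun x hx n => hθ.label_mem_labels hx)
    fun x hx => oExtend_of_mem hx fun x => (θ x).lift h
  refine ⟨g, ?_⟩
  rintro a (rfl | ha)
  · rw [Atom.map_subst_lift, Atom.map_subst_congr hgθ]
    exact .fire σ hσ _ fun b hb => Atom.map_subst_lift h θ b ▸ hI (hθ b hb)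
  · have : a.map (GTerm.lift g) = a.map (GTerm.lift h) :=
      Atom.map_congr fun i => GTerm.lift_congr fun n hn => hgh (mem_labels.2 ⟨a, ha, i, hn⟩)
    exact this ▸ hI ha

theorem MapsIntoOChase.entails (h : MapsIntoOChase D S I) {q : BCQ ar C V} (hq : Entails I q) :
    Entails (ochase D S) q := by
  obtain ⟨h, hI⟩ := h
  exact hq.map (fun _ => rfl) hI

end Soundness

/-! ### Fresh nulls -/

section Fresh

variable {P : Type*} {ar : P → ℕ} {C V : Type*} {S : Finset (Rule ar C V)} {I J : Set (Fact ar C)}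

theorem finite_database (D : Finset (Atom ar C)) : (database D : Set (Fact ar C)).Finite := by
  refine (D.finite_toSet.image (Atom.map GTerm.const)).subset ?_
  rintro _ ⟨d, hd, rfl⟩
  exact ⟨d, hd, rfl⟩

theorem finite_labels (hI : I.Finite) : (labels I).Finite := by
  have : (⋃ a ∈ I, Set.range fun i => (a.args i).label).Finite :=
    hI.biUnion fun _ _ => Set.finite_range _
  refine (this.preimage (Option.some_injective ℕ).injOn).subset fun n hn => ?_
  obtain ⟨a, ha, i, hi⟩ := mem_labels.1 hn
  exact Set.mem_biUnion ha ⟨i, hi⟩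

theorem exists_freshOn (σ : Rule ar C V) (θ : V → GTerm C ℕ) {L : Set ℕ} (hL : L.Finite) :
    ∃ θ', Set.EqOn θ' θ σ.bodyVars ∧ FreshOn σ θ' L := by
  classical
  obtain ⟨B, hB⟩ := hL.bddAbove
  have hfin : σ.existVars.Finite := σ.head.finite_setOf_hasVar.subset fun _ hy => hy.1
  obtain ⟨f, hf⟩ := Set.countable_iff_exists_injOn.1 hfin.countable
  refine ⟨fun x => if x ∈ σ.bodyVars then θ x else .null (B + 1 + f x),
    fun x hx => if_pos hx, fun y hy => ⟨B + 1 + f y, fun hn => ?_, if_neg hy.2⟩,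
    fun y hy z hz h => hf hy hz ?_⟩
  · have := hB hn
    omega
  · simpa only [hy.2, hz.2, if_false, GTerm.null.injEq, Nat.add_left_cancel_iff] using h

theorem Applicable.congr {σ : Rule ar C V} {θ θ' : V → GTerm C ℕ} (h : Applicable σ θ I)
    (hθ' : Set.EqOn θ' θ σ.bodyVars) : Applicable σ θ' I := by
  intro b hb
  rw [Atom.map_subst_congr fun x hx => hθ' ⟨b, hb, hx⟩]
  exact h b hb

theorem parsimoniouslyClosed_of_not_homomorphismCheck {L : Set ℕ} (hL : L.Finite)
    (h : ∀ σ ∈ S, ∀ θ, Applicable σ θ J → FreshOn σ θ L →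
      ¬ HomomorphismCheck J (σ.head.map (Term.subst θ))) : ParsimoniouslyClosed S J := by
  intro σ hσ θ hθ
  obtain ⟨θ', hθ', hfresh⟩ := exists_freshOn σ θ hL
  obtain ⟨g, hg, hgJ⟩ := not_not.1 (h σ hσ θ' (hθ.congr hθ') hfresh)
  exact ⟨g, hg, g ∘ θ', fun x hx => congrArg g (hθ' hx), Atom.map_subst_map hg.1 θ' _ ▸ hgJ⟩

theorem HomomorphismCheck.notMem {a : Fact ar C} (h : HomomorphismCheck I a) : a ∉ I :=
  fun ha => h ⟨id, ⟨fun _ => rfl, fun _ => rfl⟩, ha⟩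

end Fresh

/-! ### Finiteness -/

section Finiteness

variable {P : Type*} {ar : P → ℕ} {C V : Type*}

theorem exists_isHom_apply_eq {ι : Type*} {u v : ι → GTerm C ℕ}
    (hrigid : ∀ i, v i ∉ Set.range GTerm.null → u i = v i)
    (heq : ∀ i j, v i = v j → u i = u j) : ∃ g, IsHom g ∧ ∀ i, g (v i) = u i := by
  have hfactors : u.FactorsThrough v := fun i j => heq i j
  have hfix : ∀ t, t ∉ Set.range GTerm.null → Function.extend v u id t = t := by
    intro t ht
    by_cases h : ∃ i, v i = t
    · obtain ⟨i, rfl⟩ := h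
      rw [hfactors.extend_apply, hrigid i ht]
    · rw [Function.extend_apply' _ _ _ h, id]
  exact ⟨Function.extend v u id, ⟨fun c => hfix _ nofun, fun n => hfix _ nofun⟩,
    hfactors.extend_apply id⟩

/-- The term itself if homomorphisms fix it, that is, if it is not a null. -/
def GTerm.rigid : GTerm C ℕ → Option (GTerm C ℕ)
  | .null _ => none
  | t => some t

theorem GTerm.eq_of_rigid_eq {s t : GTerm C ℕ} (h : s.rigid = t.rigid)
    (ht : t ∉ Set.range GTerm.null) : s = t := by
  cases t with
  | null n => exact absurd ⟨n, rfl⟩ ht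
  | const c => cases s <;> first | exact Option.some.inj h | cases h
  | frozen n => cases s <;> first | exact Option.some.inj h | cases h

theorem GTerm.rigid_mem {K : Set (GTerm C ℕ)} {t : GTerm C ℕ}
    (ht : t ∈ Set.range GTerm.null ∪ K) : t.rigid ∈ insert none (some '' K) := by
  cases t with
  | null n => exact .inl rfl
  | const c => exact .inr ⟨_, ht.resolve_left nofun, rfl⟩
  | frozen n => exact .inr ⟨_, ht.resolve_left nofun, rfl⟩

/-- The predicate, the terms that homomorphisms fix, and the equalities between the terms of a
fact. This determines the fact up to homomorphisms in both directions. -/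
def Atom.pattern (a : Fact ar C) :
    (p : P) × ((Fin (ar p) → Option (GTerm C ℕ)) × (Fin (ar p) → Fin (ar p) → Prop)) :=
  ⟨a.pred, fun i => (a.args i).rigid, fun i j => a.args i = a.args j⟩

theorem exists_isHom_of_pattern_eq {a b : Fact ar C} (h : a.pattern = b.pattern) :
    ∃ g, IsHom g ∧ b.map g = a := by
  obtain ⟨p, u⟩ := a
  obtain ⟨p', v⟩ := b
  simp only [Atom.pattern, Sigma.mk.injEq] at h
  obtain ⟨rfl, h⟩ := h
  obtain ⟨hrigid, heq⟩ := Prod.mk.inj (eq_of_heq h)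
  obtain ⟨g, hg, hgv⟩ := exists_isHom_apply_eq (u := u) (v := v)
    (fun i => GTerm.eq_of_rigid_eq (congrFun hrigid i))
    fun i j => (congrFun (congrFun heq i) j).mpr
  exact ⟨g, hg, congrArg (Atom.mk p) (funext hgv)⟩

theorem finite_image_pattern {Q : Set P} (hQ : Q.Finite) {K : Set (GTerm C ℕ)} (hK : K.Finite) :
    (Atom.pattern '' {a : Fact ar C | a.pred ∈ Q ∧
      ∀ i, a.args i ∈ Set.range GTerm.null ∪ K}).Finite := by
  have hrigid : (insert none (some '' K)).Finite := (hK.image some).insert none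
  refine (hQ.biUnion fun p _ => ((Set.Finite.pi' fun _ : Fin (ar p) => hrigid).prod
    (Set.finite_univ (α := Fin (ar p) → Fin (ar p) → Prop))).image (Sigma.mk p)).subset ?_
  rintro _ ⟨a, ⟨hp, hargs⟩, rfl⟩
  exact Set.mem_biUnion hp ⟨_, ⟨fun i => GTerm.rigid_mem (hargs i), trivial⟩, rfl⟩

/-- The facts that the rules in `S` can generate, as far as predicates and non-null terms are
concerned, from facts of `B`. Substituting a null for the variables of the heads leaves their
constants, as all nulls are allowed anyway. -/
def factsOver (S : Finset (Rule ar C V)) (B : Set (Fact ar C)) : Set (Fact ar C) :=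
  {a | a.pred ∈ Atom.pred '' B ∪ (fun σ => σ.head.pred) '' (S : Set (Rule ar C V)) ∧
    ∀ i, a.args i ∈ Set.range GTerm.null ∪ ((⋃ b ∈ B, Set.range b.args) ∪
      ⋃ σ ∈ S, Set.range fun j => (σ.head.args j).subst fun _ => .null 0)}

variable {S : Finset (Rule ar C V)} {B I : Set (Fact ar C)}

theorem subset_factsOver : B ⊆ factsOver S B := fun a ha =>
  ⟨.inl ⟨a, ha, rfl⟩, fun i => .inr (.inl (Set.mem_biUnion ha ⟨i, rfl⟩))⟩

theorem head_mem_factsOver (hI : I ⊆ factsOver S B) {σ : Rule ar C V} (hσ : σ ∈ S)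
    {θ : V → GTerm C ℕ} (hθ : Applicable σ θ I)
    (hnull : ∀ y ∈ σ.existVars, θ y ∈ Set.range GTerm.null) :
    σ.head.map (Term.subst θ) ∈ factsOver S B := by
  refine ⟨.inr ⟨σ, hσ, rfl⟩, fun i => ?_⟩
  change Fin (ar σ.head.pred) at i
  cases hi : σ.head.args i with
  | const c =>
    refine .inr (.inr (Set.mem_biUnion hσ ⟨i, ?_⟩))
    simp only [Atom.map, hi, Term.subst]
  | var x =>
    rw [Atom.map_subst_args hi]
    by_cases hx : x ∈ σ.bodyVars
    · obtain ⟨b, hb, j, hj⟩ := hx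
      exact Atom.map_subst_args (θ := θ) hj ▸ (hI (hθ b hb)).2 j
    · exact .inl (hnull x ⟨⟨i, hi⟩, hx⟩)

theorem FreshOn.mem_range_null {σ : Rule ar C V} {θ : V → GTerm C ℕ} {L : Set ℕ}
    (h : FreshOn σ θ L) : ∀ y ∈ σ.existVars, θ y ∈ Set.range GTerm.null := fun y hy =>
  let ⟨n, _, hn⟩ := h.1 y hy
  ⟨n, hn.symm⟩

/-- The set `I` of facts is generated from facts of `B` by rules in `S` subject to a homomorphism
check, as far as this is needed to bound its size: among the generated facts, no pattern is
repeated. -/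
structure ParsimoniousOver (S : Finset (Rule ar C V)) (B I : Set (Fact ar C)) : Prop where
  subset_factsOver : I ⊆ factsOver S B
  injOn_pattern : Set.InjOn Atom.pattern (I \ B)

theorem ParsimoniousOver.of_subset (hI : I ⊆ B) : ParsimoniousOver S B I where
  subset_factsOver := hI.trans StreamingChase.subset_factsOver
  injOn_pattern := by
    rw [Set.sdiff_eq_empty.2 hI]
    exact Set.injOn_empty _

theorem ParsimoniousOver.insert_mem (h : ParsimoniousOver S B I) {a : Fact ar C} (ha : a ∈ B) :
    ParsimoniousOver S B (insert a I) where
  subset_factsOver := Set.insert_subset (StreamingChase.subset_factsOver ha) h.subset_factsOver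
  injOn_pattern := by
    rw [Set.insert_sdiff_of_mem I ha]
    exact h.injOn_pattern

theorem ParsimoniousOver.insert_head (h : ParsimoniousOver S B I) {σ : Rule ar C V} (hσ : σ ∈ S)
    {θ : V → GTerm C ℕ} (hθ : Applicable σ θ I)
    (hnull : ∀ y ∈ σ.existVars, θ y ∈ Set.range GTerm.null)
    (hcheck : HomomorphismCheck I (σ.head.map (Term.subst θ))) :
    ParsimoniousOver S B (insert (σ.head.map (Term.subst θ)) I) where
  subset_factsOver :=
    Set.insert_subset (head_mem_factsOver h.subset_factsOver hσ hθ hnull) h.subset_factsOver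
  injOn_pattern := by
    have new_pattern : (σ.head.map (Term.subst θ)).pattern ∉ Atom.pattern '' (I \ B) := by
      rintro ⟨b, hb, hpattern⟩
      obtain ⟨g, hg, hgb⟩ := exists_isHom_of_pattern_eq hpattern
      exact hcheck ⟨g, hg, hgb ▸ hb.1⟩
    by_cases hB : σ.head.map (Term.subst θ) ∈ B
    · rw [Set.insert_sdiff_of_mem I hB]
      exact h.injOn_pattern
    · rw [Set.insert_sdiff_of_notMem I hB, Set.injOn_insert fun h => hcheck.notMem h.1]
      exact ⟨h.injOn_pattern, new_pattern⟩

theorem ParsimoniousOver.iUnion {f : ℕ → Set (Fact ar C)} (hf : Monotone f)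
    (h : ∀ k, ParsimoniousOver S B (f k)) : ParsimoniousOver S B (⋃ k, f k) where
  subset_factsOver := Set.iUnion_subset fun k => (h k).subset_factsOver
  injOn_pattern := by
    rintro a ⟨ha, haB⟩ b ⟨hb, hbB⟩ hab
    obtain ⟨k, hk⟩ := Set.mem_iUnion.1 ha
    obtain ⟨l, hl⟩ := Set.mem_iUnion.1 hb
    exact (h (max k l)).injOn_pattern ⟨hf (le_max_left k l) hk, haB⟩
      ⟨hf (le_max_right k l) hl, hbB⟩ hab

theorem ParsimoniousOver.finite (h : ParsimoniousOver S B I) (hB : B.Finite) : I.Finite := by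
  have hpreds := (hB.image Atom.pred).union
    (S.finite_toSet.image fun σ : Rule ar C V => σ.head.pred)
  have hterms := (hB.biUnion fun b _ => Set.finite_range b.args).union
    (S.finite_toSet.biUnion fun σ _ =>
      Set.finite_range fun j => (σ.head.args j).subst fun _ => (.null 0 : GTerm C ℕ))
  have hnew : (I \ B).Finite := Set.Finite.of_injOn
    (fun a ha => Set.mem_image_of_mem _ (h.subset_factsOver ha.1)) h.injOn_pattern
    (finite_image_pattern hpreds hterms)
  exact (hnew.union hB).subset (Set.subset_sdiff_union I B)

theorem not_finite_iUnion_of_ssubset {α : Type*} {f : ℕ → Set α} (h : ∀ k, f k ⊂ f (k + 1)) :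
    ¬ (⋃ k, f k).Finite :=
  Set.infinite_iUnion (strictMono_nat_of_lt_succ h).injective

theorem exists_terminal {α : Type*} {R : α → α → Prop} {x : α}
    (h : ¬ ∃ run : ℕ → α, run 0 = x ∧ ∀ k, R (run k) (run (k + 1))) :
    ∃ y, Relation.ReflTransGen R x y ∧ ∀ z, ¬ R y z := by
  have hacc : Acc (flip R) x := by
    by_contra hx
    exact h (not_acc_iff_exists_descending_chain.1 hx)
  clear h
  induction hacc with
  | intro x _ ih =>
    by_cases hx : ∃ z, R x z
    · obtain ⟨z, hz⟩ := hx
      obtain ⟨y, hzy, hy⟩ := ih z hz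
      exact ⟨y, hzy.head hz, hy⟩
    · exact ⟨x, .refl, not_exists.1 hx⟩

end Finiteness

/-! ### Parsimonious chase -/

section PChase

variable {P : Type*} {ar : P → ℕ} {C V : Type*} {D : Finset (Atom ar C)}
  {S : Finset (Rule ar C V)} {B I J : Set (Fact ar C)} {r : ℕ}

theorem PStep.ssubset (h : PStep S I J) : I ⊂ J := by
  obtain ⟨σ, -, θ, -, -, hcheck, rfl⟩ := h
  exact Set.ssubset_insert hcheck.notMem

theorem ParsimoniousOver.pStep (hI : ParsimoniousOver S B I) (h : PStep S I J) :
    ParsimoniousOver S B J := by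
  obtain ⟨σ, hσ, θ, hθ, hfresh, hcheck, rfl⟩ := h
  exact hI.insert_head hσ hθ hfresh.mem_range_null hcheck

theorem exists_isPChase (S : Finset (Rule ar C V)) (hI : I.Finite) : ∃ J, IsPChase I S J := by
  refine exists_terminal ?_
  rintro ⟨run, rfl, hrun⟩
  have hmono : Monotone run := monotone_nat_of_le_succ fun k => (hrun k).ssubset.subset
  have hover : ∀ k, ParsimoniousOver S (run 0) (run k) := by
    intro k
    induction k with
    | zero => exact .of_subset subset_rfl
    | succ k ih => exact ih.pStep (hrun k)
  exact not_finite_iUnion_of_ssubset (fun k => (hrun k).ssubset)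
    ((ParsimoniousOver.iUnion hmono hover).finite hI)

theorem IsPChase.subset (h : IsPChase I S J) : I ⊆ J := by
  obtain ⟨h, -⟩ := h
  induction h with
  | refl => exact subset_rfl
  | tail _ hstep ih => exact ih.trans hstep.ssubset.subset

theorem IsPChase.finite (h : IsPChase I S J) (hI : I.Finite) : J.Finite := by
  obtain ⟨h, -⟩ := h
  induction h with
  | refl => exact hI
  | tail _ hstep ih =>
    obtain ⟨σ, -, θ, -, -, -, rfl⟩ := hstep
    exact ih.insert _

theorem IsPChase.parsimoniouslyClosed (h : IsPChase I S J) (hI : I.Finite) :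
    ParsimoniouslyClosed S J :=
  parsimoniouslyClosed_of_not_homomorphismCheck (finite_labels (h.finite hI))
    fun σ hσ θ hθ hfresh hcheck => h.2 _ ⟨σ, hσ, θ, hθ, hfresh, hcheck, rfl⟩

theorem MapsIntoOChase.isPChase (hI : MapsIntoOChase D S I) (h : IsPChase I S J) :
    MapsIntoOChase D S J := by
  obtain ⟨h, -⟩ := h
  induction h with
  | refl => exact hI
  | tail _ hstep ih =>
    obtain ⟨σ, hσ, θ, hθ, hfresh, -, rfl⟩ := hstep
    exact ih.insert_head hσ hθ hfresh

theorem IsPChaseR.finite (h : IsPChaseR D S r I) : I.Finite := by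
  induction h with
  | zero => exact finite_database D
  | succ _ _ _ _ hJ ih => exact hJ.finite (ih.image _)

theorem exists_isPChaseR (D : Finset (Atom ar C)) (S : Finset (Rule ar C V)) (r : ℕ) :
    ∃ I, IsPChaseR D S r I := by
  induction r with
  | zero => exact ⟨_, .zero⟩
  | succ r ih =>
    obtain ⟨I, hI⟩ := ih
    obtain ⟨J, hJ⟩ := exists_isPChase S (hI.finite.image (Atom.map GTerm.freeze))
    exact ⟨J, .succ r I J hI hJ⟩

theorem IsPChaseR.mapsIntoOChase [Nonempty C] (h : IsPChaseR D S r I) :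
    MapsIntoOChase D S I := by
  induction h with
  | zero => exact mapsIntoOChase_database D S
  | succ _ _ _ _ hJ ih =>
    exact (ih.union_image_freeze.mono Set.subset_union_right).isPChase hJ

theorem IsPChaseR.covers (hS : Shy S) (h : IsPChaseR D S (r + 1) J) : Covers D S r J := by
  induction r generalizing J with
  | zero =>
    obtain _ | ⟨_, _, _, ⟨⟩, hJ⟩ := h
    exact covers_zero hS (database_subset_of_freeze subset_rfl hJ.subset)
      (hJ.parsimoniouslyClosed ((finite_database D).image _))
  | succ r ih =>
    obtain _ | ⟨_, _, _, hI, hJ⟩ := h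
    exact (ih hI).succ hS hJ.subset (hJ.parsimoniouslyClosed (hI.finite.image _))

theorem IsPChaseR.entails_iff [Nonempty C] (hS : Shy S) {q : BCQ ar C V} (hq : numVars q < r)
    (h : IsPChaseR D S r I) : Entails (ochase D S) q ↔ Entails I q := by
  obtain _ | r := r
  · exact absurd hq (Nat.not_lt_zero _)
  · exact ⟨(h.covers hS).entails (Nat.lt_succ_iff.1 hq), h.mapsIntoOChase.entails⟩

end PChase

/-! ### Streaming chase -/

section AggregateTrees

variable {P : Type*} {ar : P → ℕ} {C : Type*}

/-- The aggregate fact trees of a set of facts, given by their node labels, which are the prefixes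
of the argument tuples. -/
def aggregateTrees (I : Set (Fact ar C)) (p : P) : AFTree C :=
  {l | ∃ a ∈ I, a.pred = p ∧ l <+: List.ofFn a.args}

theorem isLeaf_aggregateTrees {I : Set (Fact ar C)} {p : P} {t : List (GTerm C ℕ)} :
    (aggregateTrees I p).IsLeaf t ↔ ∃ a ∈ I, a.pred = p ∧ t = List.ofFn a.args := by
  constructor
  · rintro ⟨⟨a, ha, hp, s, hs⟩, hleaf⟩
    cases s with
    | nil => exact ⟨a, ha, hp, by simpa using hs⟩
    | cons x s => exact absurd ⟨a, ha, hp, s, by simpa using hs⟩ (hleaf x)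
  · rintro ⟨a, ha, rfl, rfl⟩
    refine ⟨⟨a, ha, rfl, List.prefix_rfl⟩, ?_⟩
    rintro x ⟨b, -, hb, hlb⟩
    have hlength := hlb.length_le
    simp [hb] at hlength

theorem homomorphismCheckS_aggregateTrees_iff (I : Set (Fact ar C)) (a : Fact ar C) :
    HomomorphismCheckS (aggregateTrees I) a ↔ HomomorphismCheck I a := by
  refine not_congr (exists_congr fun g => and_congr_right fun _ => ?_)
  simp only [isLeaf_aggregateTrees, List.map_ofFn]
  constructor
  · rintro ⟨t, ⟨⟨p, u⟩, hb, rfl, rfl⟩, h⟩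
    obtain rfl := List.ofFn_injective h
    exact hb
  · exact fun h => ⟨_, ⟨_, h, rfl, rfl⟩, rfl⟩

end AggregateTrees

section Pipeline

variable {P : Type*} {ar : P → ℕ} {C V : Type*} {D : Finset (Atom ar C)}
  {S : Finset (Rule ar C V)} {F : FiringCondition ar C} {maxRes : ℕ} {s s' : State ar C V}

/-- The facts of all iterations. -/
def State.allFacts (s : State ar C V) : Set (Fact ar C) := ⋃ i, s.facts i

theorem State.facts_subset_allFacts (s : State ar C V) (i : ℕ) : s.facts i ⊆ s.allFacts :=
  Set.subset_iUnion s.facts i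

theorem State.labels_eq (s : State ar C V) : s.labels = StreamingChase.labels s.allFacts := by
  ext n
  simp only [State.labels, StreamingChase.labels, State.allFacts, Set.mem_ofPred_eq, Set.mem_iUnion]
  exact ⟨fun ⟨i, a, ha, h⟩ => ⟨a, ⟨i, ha⟩, h⟩, fun ⟨a, ⟨i, ha⟩, h⟩ => ⟨i, a, ha, h⟩⟩

theorem State.facts_emit_self (s : State ar C V) (i : ℕ) (a : Fact ar C) :
    (s.emit i a).facts i = insert a (s.facts i) := by
  ext b
  simp [State.emit, or_comm]

theorem State.facts_emit_of_ne (s : State ar C V) {i j : ℕ} (h : j ≠ i) (a : Fact ar C) :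
    (s.emit i a).facts j = s.facts j := by
  ext b
  simp [State.emit, h]

theorem State.allFacts_emit (s : State ar C V) (i : ℕ) (a : Fact ar C) :
    (s.emit i a).allFacts = insert a s.allFacts := by
  ext b
  simp [State.allFacts, State.emit, exists_or, or_comm]

/-- The consistency properties of a state that hold in every execution of the streaming chase,
whatever the firing condition. -/
structure State.Valid (D : Finset (Atom ar C)) (S : Finset (Rule ar C V)) (maxRes : ℕ)
    (s : State ar C V) : Prop where
  finite_allFacts : s.allFacts.Finite
  iteration_le : ∀ i, ∀ a ∈ s.facts i, i ≤ max 1 maxRes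
  trees_eq : ∀ i, s.trees i = aggregateTrees (s.facts i)
  pulled_subset : ∀ i σ, s.pulled i σ ⊆ s.facts i
  mem_of_pulled : ∀ i σ, ∀ a ∈ s.pulled i σ, σ ∈ S
  database_subset : database D ⊆ s.facts 1

theorem State.valid_init : (State.init D : State ar C V).Valid D S maxRes where
  finite_allFacts := (finite_database D).subset (Set.iUnion_subset fun _ _ ha => ha.2)
  iteration_le i a ha := ha.1 ▸ le_max_left 1 maxRes
  trees_eq i := by
    ext p l
    simp only [State.init, aggregateTrees, Set.mem_ofPred_eq, and_assoc, exists_and_left]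
  pulled_subset _ _ _ := False.elim
  mem_of_pulled _ _ _ := False.elim
  database_subset _ ha := ⟨rfl, ha⟩

theorem State.Valid.emit (hs : s.Valid D S maxRes) {i : ℕ} (hi : i ≤ max 1 maxRes)
    (a : Fact ar C) : (s.emit i a).Valid D S maxRes where
  finite_allFacts := s.allFacts_emit i a ▸ hs.finite_allFacts.insert a
  iteration_le j b hb := hb.elim (hs.iteration_le j b) fun h => h.1 ▸ hi
  trees_eq j := by
    ext p l
    simp only [State.emit, hs.trees_eq, aggregateTrees, Set.mem_ofPred_eq]
    constructor
    · rintro (⟨b, hb, h⟩ | ⟨hj, rfl, h⟩)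
      · exact ⟨b, .inl hb, h⟩
      · exact ⟨a, .inr ⟨hj, rfl⟩, rfl, h⟩
    · rintro ⟨b, hb | ⟨hj, rfl⟩, rfl, h⟩
      · exact .inl ⟨b, hb, rfl, h⟩
      · exact .inr ⟨hj, rfl, h⟩
  pulled_subset j σ b hb := .inl (hs.pulled_subset j σ hb)
  mem_of_pulled := hs.mem_of_pulled
  database_subset b hb := .inl (hs.database_subset hb)

theorem State.Valid.pull (hs : s.Valid D S maxRes) {i : ℕ} {σ : Rule ar C V} (hσ : σ ∈ S)
    {a : Fact ar C} (ha : a ∈ s.facts i) : (s.pull i σ a).Valid D S maxRes where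
  finite_allFacts := hs.finite_allFacts
  iteration_le := hs.iteration_le
  trees_eq := hs.trees_eq
  pulled_subset := by
    rintro j τ b (hb | ⟨rfl, rfl, rfl⟩)
    · exact hs.pulled_subset j τ hb
    · exact ha
  mem_of_pulled := by
    rintro j τ b (hb | ⟨rfl, rfl, rfl⟩)
    · exact hs.mem_of_pulled j τ b hb
    · exact hσ
  database_subset := hs.database_subset

theorem State.Valid.step (hs : s.Valid D S maxRes) (h : SStep S F maxRes s s') :
    s'.Valid D S maxRes := by
  cases h with
  | pull i σ hσ a ha => exact hs.pull hσ ha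
  | fire i σ _ θ hi => exact hs.emit (hi.2.trans (le_max_right ..)) _
  | resume i hi a => exact hs.emit (hi.2.trans_le (le_max_right 1 maxRes)) _

theorem State.valid_of_reachable (h : Relation.ReflTransGen (SStep S F maxRes) (State.init D) s) :
    s.Valid D S maxRes := by
  induction h with
  | refl => exact State.valid_init
  | tail _ hstep ih => exact ih.step hstep

theorem State.Valid.homomorphismCheckS_iff (hs : s.Valid D S maxRes) {i : ℕ} {a : Fact ar C} :
    HomomorphismCheckS (s.trees i) a ↔ HomomorphismCheck (s.facts i) a := by
  rw [hs.trees_eq, homomorphismCheckS_aggregateTrees_iff]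

theorem State.mapsIntoOChase_of_reachable [Nonempty C]
    (h : Relation.ReflTransGen (SStep S F maxRes) (State.init D) s) :
    MapsIntoOChase D S s.allFacts := by
  induction h with
  | refl => exact (mapsIntoOChase_database D S).mono (Set.iUnion_subset fun _ _ ha => ha.2)
  | @tail s _ hreach hstep ih =>
    have hs : s.Valid D S maxRes := State.valid_of_reachable hreach
    cases hstep with
    | pull => exact ih
    | fire i σ hσ θ hi hθ hfresh =>
      rw [State.allFacts_emit]
      exact ih.insert_head hσ
        (fun b hb => s.facts_subset_allFacts i (hs.pulled_subset i σ (hθ b hb)))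
        (s.labels_eq ▸ hfresh)
    | resume i hi a ha =>
      rw [State.allFacts_emit]
      exact ih.union_image_freeze.mono (Set.insert_subset
        (.inr ⟨a, s.facts_subset_allFacts i ha, rfl⟩) Set.subset_union_left)

/-- The facts of the iterations (marked by `none`) and the facts pulled by the node of each rule `σ`
(marked by `some σ`) as a single set, which grows in every step. -/
def State.content (s : State ar C V) : Set (ℕ × Option (Rule ar C V) × Fact ar C) :=
  {x | x.2.2 ∈ x.2.1.elim (s.facts x.1) (s.pulled x.1)}

theorem State.content_ssubset_emit {i : ℕ} {a : Fact ar C} (h : a ∉ s.facts i) :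
    s.content ⊂ (s.emit i a).content := by
  refine Set.ssubset_iff_exists.2 ⟨?_, (i, none, a), .inr ⟨rfl, rfl⟩, h⟩
  rintro ⟨j, _ | σ, b⟩ hb
  · exact .inl hb
  · exact hb

theorem State.content_ssubset_pull {i : ℕ} {σ : Rule ar C V} {a : Fact ar C}
    (h : a ∉ s.pulled i σ) : s.content ⊂ (s.pull i σ a).content := by
  refine Set.ssubset_iff_exists.2 ⟨?_, (i, some σ, a), .inr ⟨rfl, rfl, rfl⟩, h⟩
  rintro ⟨j, _ | τ, b⟩ hb
  · exact hb
  · exact .inl hb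

theorem State.Valid.content_ssubset (hs : s.Valid D S maxRes)
    (h : SStep S HomomorphismCheckS maxRes s s') : s.content ⊂ s'.content := by
  cases h with
  | pull i σ hσ a ha hp hn => exact State.content_ssubset_pull hn
  | fire i σ hσ θ hi hθ hfresh hF =>
    exact State.content_ssubset_emit (hs.homomorphismCheckS_iff.1 hF).notMem
  | resume i hi a ha hn => exact State.content_ssubset_emit hn

theorem SStep.facts_subset (h : SStep S F maxRes s s') (i : ℕ) : s.facts i ⊆ s'.facts i := by
  cases h with
  | pull => exact subset_rfl
  | fire => exact fun a ha => .inl ha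
  | resume => exact fun a ha => .inl ha

theorem ParsimoniousOver.sStep {B : Set (Fact ar C)} {i : ℕ}
    (hI : ParsimoniousOver S B (s.facts i)) (hs : s.Valid D S maxRes)
    (h : SStep S HomomorphismCheckS maxRes s s')
    (hB : ∀ j, i = j + 1 → Atom.map GTerm.freeze '' s.facts j ⊆ B) :
    ParsimoniousOver S B (s'.facts i) := by
  cases h with
  | pull => exact hI
  | fire j σ hσ θ _ hθ hfresh hF =>
    by_cases hij : i = j
    · subst hij
      rw [State.facts_emit_self]
      exact hI.insert_head hσ (fun b hb => hs.pulled_subset i σ (hθ b hb)) hfresh.mem_range_null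
        (hs.homomorphismCheckS_iff.1 hF)
    · rwa [State.facts_emit_of_ne s hij]
  | resume j _ a ha =>
    by_cases hij : i = j + 1
    · subst hij
      rw [State.facts_emit_self]
      exact hI.insert_mem (hB j rfl ⟨a, ha, rfl⟩)
    · rwa [State.facts_emit_of_ne s hij]

section Run

variable {run : ℕ → State ar C V} (h0 : run 0 = State.init D)
  (hrun : ∀ k, SStep S HomomorphismCheckS maxRes (run k) (run (k + 1)))

include h0 hrun

theorem State.valid_run (k : ℕ) : (run k).Valid D S maxRes := by
  induction k with
  | zero => exact h0 ▸ State.valid_init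
  | succ k ih => exact ih.step (hrun k)

theorem finite_iUnion_facts_of_freeze {B : Set (Fact ar C)} (hBfin : B.Finite)
    (hD : database D ⊆ B) {i : ℕ}
    (hB : ∀ j, i = j + 1 → Atom.map GTerm.freeze '' (⋃ k, (run k).facts j) ⊆ B) :
    (⋃ k, (run k).facts i).Finite := by
  refine (ParsimoniousOver.iUnion (monotone_nat_of_le_succ fun k => (hrun k).facts_subset i)
    fun k => ?_).finite hBfin (S := S)
  induction k with
  | zero => exact .of_subset (h0 ▸ fun a ha => hD ha.2)
  | succ k ih =>
    exact ih.sStep (State.valid_run h0 hrun k) (hrun k) fun j hj =>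
      (Set.image_mono (Set.subset_iUnion (fun k => (run k).facts j) k)).trans (hB j hj)

theorem finite_iUnion_facts (i : ℕ) : (⋃ k, (run k).facts i).Finite := by
  induction i with
  | zero => exact finite_iUnion_facts_of_freeze h0 hrun (finite_database D) subset_rfl nofun
  | succ i ih =>
    refine finite_iUnion_facts_of_freeze h0 hrun
      ((finite_database D).union (ih.image (Atom.map GTerm.freeze))) Set.subset_union_left ?_
    rintro _ ⟨⟩
    exact Set.subset_union_right

theorem finite_iUnion_content : (⋃ k, (run k).content).Finite := by
  refine ((Set.finite_Iic (max 1 maxRes)).prod (((S.finite_toSet.image some).insert none).prod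
    ((Set.finite_Iic (max 1 maxRes)).biUnion fun i _ => finite_iUnion_facts h0 hrun i))).subset ?_
  rintro ⟨i, o, a⟩ hx
  obtain ⟨k, hk⟩ := Set.mem_iUnion.1 hx
  have hvalid := State.valid_run h0 hrun k
  have ha : a ∈ (run k).facts i := by
    cases o with
    | none => exact hk
    | some σ => exact hvalid.pulled_subset i σ hk
  have hi := hvalid.iteration_le i a ha
  refine ⟨hi, ?_, Set.mem_biUnion hi (Set.mem_iUnion.2 ⟨k, ha⟩)⟩
  cases o with
  | none => exact .inl rfl
  | some σ => exact .inr ⟨σ, hvalid.mem_of_pulled i σ a hk, rfl⟩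

end Run

theorem streamingChaseTerminates (D : Finset (Atom ar C)) (S : Finset (Rule ar C V)) (maxRes : ℕ) :
    StreamingChaseTerminates D S HomomorphismCheckS maxRes := by
  rintro ⟨run, h0, hrun⟩
  exact not_finite_iUnion_of_ssubset
    (fun k => (State.valid_run h0 hrun k).content_ssubset (hrun k)) (finite_iUnion_content h0 hrun)

theorem exists_isStreamingChase (D : Finset (Atom ar C)) (S : Finset (Rule ar C V)) (maxRes : ℕ) :
    ∃ J, IsStreamingChase D S HomomorphismCheckS maxRes J :=
  let ⟨s, hs, hend⟩ := exists_terminal (streamingChaseTerminates D S maxRes)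
  ⟨_, s, hs, hend, rfl⟩

theorem State.Valid.parsimoniouslyClosed (hs : s.Valid D S maxRes)
    (hend : ∀ s', ¬ SStep S HomomorphismCheckS maxRes s s') {i : ℕ} (hi : 1 ≤ i ∧ i ≤ maxRes) :
    ParsimoniouslyClosed S (s.facts i) := by
  refine parsimoniouslyClosed_of_not_homomorphismCheck
    (s.labels_eq ▸ finite_labels hs.finite_allFacts) fun σ hσ θ hθ hfresh hcheck => ?_
  have pulled : Applicable σ θ (s.pulled i σ) := by
    intro b hb
    by_contra hn
    exact hend _ (.pull s i σ hσ _ (hθ b hb) ⟨b, hb, rfl⟩ hn)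
  exact hend _ (.fire s i σ hσ θ hi pulled hfresh (hs.homomorphismCheckS_iff.2 hcheck))

theorem State.Valid.covers (hS : Shy S) (hs : s.Valid D S maxRes)
    (hend : ∀ s', ¬ SStep S HomomorphismCheckS maxRes s s') {r : ℕ} (hr : r < maxRes) :
    Covers D S r (s.facts (r + 1)) := by
  have hclosed : ParsimoniouslyClosed S (s.facts (r + 1)) :=
    hs.parsimoniouslyClosed hend ⟨Nat.le_add_left 1 r, hr⟩
  induction r with
  | zero => exact covers_zero hS hs.database_subset hclosed
  | succ r ih =>
    have hr' : r < maxRes := Nat.lt_of_succ_lt hr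
    have resumed : Atom.map GTerm.freeze '' s.facts (r + 1) ⊆ s.facts (r + 1 + 1) := by
      rintro _ ⟨a, ha, rfl⟩
      by_contra hn
      exact hend _ (.resume s (r + 1) ⟨Nat.le_add_left 1 r, hr⟩ a ha hn)
    exact (ih hr' (hs.parsimoniouslyClosed hend ⟨Nat.le_add_left 1 r, hr'⟩)).succ hS resumed hclosed

theorem IsStreamingChase.entails_iff [Nonempty C] (hS : Shy S) {q : BCQ ar C V}
    (hq : numVars q < maxRes) {J : Set (Fact ar C)}
    (h : IsStreamingChase D S HomomorphismCheckS maxRes J) :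
    Entails (ochase D S) q ↔ Entails J q := by
  obtain ⟨s, hreach, hend, rfl⟩ := h
  obtain _ | r := maxRes
  · exact absurd hq (Nat.not_lt_zero _)
  · have hcovers := (State.valid_of_reachable hreach).covers hS hend (Nat.lt_succ_self r)
    have hsound := (State.mapsIntoOChase_of_reachable hreach).mono (s.facts_subset_allFacts (r + 1))
    exact ⟨hcovers.entails (Nat.lt_succ_iff.1 hq), hsound.entails⟩

end Pipeline

end StreamingChase

open StreamingChase in
theorem mainTheorem1_general {P C V : Type*} [Nonempty C] {ar : P → ℕ} (D : Finset (Atom ar C))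
    (S : Finset (Rule ar C V)) (hS : Shy S) (q : BCQ ar C V) {n : ℕ} (hn : numVars q < n) :
    (∃ I, IsPChaseR D S n I) ∧
    (∃ J, IsStreamingChase D S HomomorphismCheckS n J) ∧
    StreamingChaseTerminates D S HomomorphismCheckS n ∧
    ∀ I J, IsPChaseR D S n I → IsStreamingChase D S HomomorphismCheckS n J →
      (Entails I q ↔ Entails J q) ∧ (Entails (ochase D S) q ↔ Entails J q) :=
  ⟨exists_isPChaseR D S n, exists_isStreamingChase D S n, streamingChaseTerminates D S n,
    fun _ _ hI hJ => ⟨(hI.entails_iff hS hn).symm.trans (hJ.entails_iff hS hn),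
      hJ.entails_iff hS hn⟩⟩

theorem mainTheorem1 {P C V : Type*} [Nonempty C] (ar : P → ℕ)
    (D : Finset (StreamingChase.Atom ar C)) (S : Finset (StreamingChase.Rule ar C V))
    (hS : StreamingChase.Shy S) (q : StreamingChase.BCQ ar C V) :
    (∃ I, StreamingChase.IsPChaseR D S (StreamingChase.numVars q + 1) I) ∧
    (∃ J, StreamingChase.IsStreamingChase D S StreamingChase.HomomorphismCheckS
      (StreamingChase.numVars q + 1) J) ∧
    StreamingChase.StreamingChaseTerminates D S StreamingChase.HomomorphismCheckS
      (StreamingChase.numVars q + 1) ∧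
    ∀ I J, StreamingChase.IsPChaseR D S (StreamingChase.numVars q + 1) I →
      StreamingChase.IsStreamingChase D S StreamingChase.HomomorphismCheckS
        (StreamingChase.numVars q + 1) J →
      (StreamingChase.Entails I q ↔ StreamingChase.Entails J q) ∧
      (StreamingChase.Entails (StreamingChase.ochase D S) q ↔ StreamingChase.Entails J q) :=
  mainTheorem1_general D S hS q (Nat.lt_succ_self _)
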